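/- Let $\mathscr C$ be an extension closed variety of finite groups, that is, a nonempty class of finite groups closed under subgroups, finite direct products, homomorphic images and group extensions, and let $m$ be an infinite cardinal. A pro-$\mathscr C$ group is a profinite group all of whose quotients by open normal subgroups belong to $\mathscr C$. A pro-$\mathscr C$ group $G$ is called $m$-quasifree if for all groups $A, B \in \mathscr C$ (with the discrete topology), every epimorphism $\alpha\colon A\to B$ that is not an isomorphism and that splits (there is a homomorphism $\sigma\colon B\to A$ with $\alpha\sigma=\mathrm{id}_B$), and every continuous epimorphism $\beta\colon G\to B$, there exist precisely $m$ different continuous epimorphisms $\lambda\colon G\to A$ such that $\alpha\lambda=\beta$. Theorem. Let $G$ be an $m$-quasifree pro-$\mathscr C$ group and let $H$ be an open subgroup of $G$. Then $H$ (with the subspace topology) is an $m$-quasifree pro-$\mathscr C$ group. -/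

import Mathlib

open scoped Cardinal

universe u

/-- An extension closed variety of finite groups: a nonempty class of finite groups closed under
subgroups, finite direct products, homomorphic images and extensions. The class is given as a
predicate on groups; closure under isomorphism is a special case of `image`. -/
structure IsExtensionClosedVariety (C : (A : Type u) → [Group A] → Prop) : Prop where
  finite : ∀ (A : Type u) [Group A], C A → Finite A
  nonempty : ∃ (A : Type u) (_ : Group A), C A
  subgroup : ∀ (A : Type u) [Group A], C A → ∀ K : Subgroup A, C K
  pi : ∀ (ι : Type u) [Finite ι] (A : ι → Type u) [∀ i, Group (A i)],
    (∀ i, C (A i)) → C (∀ i, A i)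
  image : ∀ (A B : Type u) [Group A] [Group B] (f : A →* B),
    Function.Surjective f → C A → C B
  extension : ∀ (A : Type u) [Group A] (N : Subgroup A) [N.Normal],
    C N → C (A ⧸ N) → C A

/-- A pro-`C` group: a profinite group all of whose continuous finite quotients (the quotients
by open normal subgroups) are in `C`. -/
structure IsProC (C : (A : Type u) → [Group A] → Prop)
    (G : Type u) [Group G] [TopologicalSpace G] : Prop where
  isTopologicalGroup : IsTopologicalGroup G
  compactSpace : CompactSpace G
  t2Space : T2Space G
  totallyDisconnectedSpace : TotallyDisconnectedSpace G
  quotient_mem : ∀ (N : Subgroup G) [N.Normal], IsOpen (N : Set G) → C (G ⧸ N)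

/-- An epimorphism that is proper (not an isomorphism) and splits. -/
structure IsProperSplitEpi {A B : Type u} [Group A] [Group B] (α : A →* B) : Prop where
  surjective : Function.Surjective α
  not_bijective : ¬ Function.Bijective α
  split : ∃ σ : B →* A, α.comp σ = MonoidHom.id B

/-- The solutions of the embedding problem given by `α : A → B` and `β : G → B`: the continuous
epimorphisms `l : G → A` with `α ∘ l = β`. -/
def solutions {G A B : Type u} [Group G] [TopologicalSpace G] [Group A] [TopologicalSpace A]
    [Group B] [TopologicalSpace B] (α : A →* B) (β : G →ₜ* B) : Set (G →ₜ* A) :=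
  {l | Function.Surjective l ∧ ∀ g, α (l g) = β g}

/-- An `m`-quasifree pro-`C` group. The finite groups `A` and `B` carry the discrete topology. -/
structure IsQuasifree (C : (A : Type u) → [Group A] → Prop) (m : Cardinal.{u})
    (G : Type u) [Group G] [TopologicalSpace G] : Prop extends IsProC C G where
  card_solutions : ∀ (A B : Type u) [Group A] [TopologicalSpace A] [DiscreteTopology A]
    [Group B] [TopologicalSpace B] [DiscreteTopology B], C A → C B →
    ∀ (α : A →* B), IsProperSplitEpi α →
    ∀ (β : G →ₜ* B), Function.Surjective β → #(solutions α β) = m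

/-!
Fix a split embedding problem `α : A → B`, `β : H → B` for the open subgroup `H`, with a section
`σ` of `α`, and put `s = σ ∘ β`. The two bounds on the number of its solutions are independent.

*At least `m` solutions.* Choose an open normal subgroup `N` of `G` inside `ker β` and let
`Γ = G ⧸ N`. The group `H` acts on `ker α` by conjugation through `s`; inducing this action to `Γ`
gives a finite group of functions `Γ → ker α`, and the resulting twisted wreath product `W`
belongs to the class and maps onto `Γ` by a proper split epimorphism. There are therefore `m`
solutions `l : G → W` over `G → Γ`. Evaluating at `1 ∈ Γ`, as in Shapiro's lemma, turns `l` into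
the homomorphism `h ↦ (l h).left 1 * s h` (`shapiro`), which is a solution for `H`
(`map_shapiro`, `shapiro_surjective`). The cocycle identity shows that `l` is determined by this
solution together with the values of `l` on coset representatives of `H` (`eq_of_shapiro_eq`).
The passage is therefore finite-to-one, and since `m` is infinite, `H` has at least `m` solutions.

*At most `m` solutions.* A nontrivial group `R` in the class gives the proper split epimorphism
`R → 1`, so `G` has exactly `m` continuous epimorphisms onto `R`, hence at most `m` continuous
homomorphisms into any finite group (`IsQuasifree.card_continuousMonoidHom_le`). A continuous
epimorphism `l : H → A` is determined, up to finitely many choices, by the permutation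
representation of `G` on the cosets of `ker l`, whose degree is `[G : H] * |A|`
(`IsQuasifree.card_surjective_subgroup_le`).
-/

open Cardinal

/-! ### Extension closed varieties -/

section Variety

variable {C : (A : Type u) → [Group A] → Prop}

theorem IsExtensionClosedVariety.of_surjective_of_ker (hC : IsExtensionClosedVariety C)
    {A B : Type u} [Group A] [Group B] (f : A →* B) (hf : Function.Surjective f)
    (hker : C f.ker) (hB : C B) : C A := by
  refine hC.extension A f.ker hker ?_
  let e := QuotientGroup.quotientKerEquivOfSurjective f hf
  exact hC.image B (A ⧸ f.ker) e.symm.toMonoidHom e.symm.surjective hB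

theorem IsExtensionClosedVariety.of_subsingleton (hC : IsExtensionClosedVariety C)
    (A : Type u) [Group A] [Subsingleton A] : C A := by
  obtain ⟨B, _, hB⟩ := hC.nonempty
  exact hC.image B A 1 (fun a => ⟨1, Subsingleton.elim _ _⟩) hB

end Variety

/-! ### Open subgroups of pro-`C` groups -/

section OpenSubgroups

variable {G : Type u} [Group G] [TopologicalSpace G]

theorem Subgroup.isOpen_normalCore [IsTopologicalGroup G] [CompactSpace G] (U : Subgroup G)
    (hU : IsOpen (U : Set G)) : IsOpen (U.normalCore : Set G) := by
  have : Finite (G ⧸ U) := U.quotient_finite_of_isOpen hU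
  have : U.FiniteIndex := Subgroup.finiteIndex_of_finite_quotient
  exact U.normalCore.isOpen_of_isClosed_of_finiteIndex
    (U.normalCore_isClosed (U.isClosed_of_isOpen hU))

theorem Subgroup.isOpen_map_subtype {H : Subgroup G} (hH : IsOpen (H : Set G)) {U : Subgroup H}
    (hU : IsOpen (U : Set H)) : IsOpen (U.map H.subtype : Set G) := by
  rw [Subgroup.coe_map]
  exact hH.isOpenMap_subtype_val _ hU

theorem ContinuousMonoidHom.isOpen_ker {A : Type*} [Group A] [TopologicalSpace A]
    [DiscreteTopology A] (f : G →ₜ* A) : IsOpen (f.toMonoidHom.ker : Set G) :=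
  (isOpen_discrete ({1} : Set A)).preimage f.continuous_toFun

theorem MonoidHom.continuous_of_isOpen_ker [IsTopologicalGroup G] {A : Type*} [Group A]
    [TopologicalSpace A] [DiscreteTopology A] (f : G →* A) (hf : IsOpen (f.ker : Set G)) :
    Continuous f := by
  refine continuous_of_continuousAt_one f ?_
  rw [ContinuousAt, nhds_discrete A, Filter.tendsto_pure, map_one]
  exact hf.mem_nhds (one_mem f.ker)

variable {C : (A : Type u) → [Group A] → Prop}

/-- The image is isomorphic to the quotient of `G` by the kernel, which is open. -/
theorem IsProC.range_mem (hC : IsExtensionClosedVariety C) (hG : IsProC C G)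
    {P : Type u} [Group P] [TopologicalSpace P] [DiscreteTopology P] (f : G →ₜ* P) :
    C f.toMonoidHom.range :=
  let e := QuotientGroup.quotientKerEquivRange f.toMonoidHom
  hC.image _ _ e.toMonoidHom e.surjective (hG.quotient_mem _ f.isOpen_ker)

/-- An open normal subgroup `N` of `H` contains the normal core `M` of `N` in `G`, which is open,
so `H ⧸ N` is a quotient of a subgroup of `G ⧸ M`. -/
theorem IsProC.of_isOpen (hC : IsExtensionClosedVariety C) (hG : IsProC C G)
    (H : Subgroup G) (hH : IsOpen (H : Set G)) : IsProC C H := by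
  have := hG.isTopologicalGroup
  have := hG.compactSpace
  have := hG.t2Space
  have := hG.totallyDisconnectedSpace
  refine ⟨inferInstance, isCompact_iff_compactSpace.mp (H.isClosed_of_isOpen hH).isCompact,
    inferInstance, inferInstance, fun N _ hN => ?_⟩
  let M := (N.map H.subtype).normalCore
  have hM : IsOpen (M : Set G) := Subgroup.isOpen_normalCore _ (Subgroup.isOpen_map_subtype hH hN)
  let f : H →* G ⧸ M := (QuotientGroup.mk' M).comp H.subtype
  have hker : f.ker ≤ N := by
    intro h hh
    have h1 : (h : G) ∈ M := (QuotientGroup.eq_one_iff _).mp hh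
    obtain ⟨n, hn, hnh⟩ := Subgroup.normalCore_le _ h1
    rwa [← Subtype.ext hnh]
  let e := QuotientGroup.quotientKerEquivRange f
  have hq : C (H ⧸ f.ker) := hC.image _ _ e.symm.toMonoidHom e.symm.surjective
    (hC.subgroup _ (hG.quotient_mem M hM) f.range)
  refine hC.image _ (H ⧸ N) (QuotientGroup.map f.ker N (MonoidHom.id H) hker) ?_ hq
  intro x
  obtain ⟨h, rfl⟩ := QuotientGroup.mk_surjective x
  exact ⟨h, rfl⟩

end OpenSubgroups

/-! ### Counting homomorphisms from a quasifree group and its open subgroups -/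

section UpperBound

variable {C : (A : Type u) → [Group A] → Prop} {m : Cardinal.{u}}
  {G : Type u} [Group G] [TopologicalSpace G]

/-- A nontrivial group `A` of the class is the source of the proper split epimorphism `A → 1`,
whose solutions are all the continuous epimorphisms `G → A`. -/
theorem IsQuasifree.card_surjective_le (hC : IsExtensionClosedVariety C) (hm : ℵ₀ ≤ m)
    (hG : IsQuasifree C m G) (A : Type u) [Group A] [TopologicalSpace A] [DiscreteTopology A]
    (hA : C A) : #{f : G →ₜ* A // Function.Surjective f} ≤ m := by
  rcases subsingleton_or_nontrivial A with h | h
  · have : Subsingleton (G →ₜ* A) := ⟨fun f g => by ext x; exact Subsingleton.elim _ _⟩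
    exact (mk_le_one_iff_set_subsingleton.mpr (Set.subsingleton_of_subsingleton)).trans
      (one_le_aleph0.trans hm)
  · have hα : IsProperSplitEpi (1 : A →* PUnit.{u + 1}) :=
      ⟨fun b => ⟨1, rfl⟩, fun hb => not_subsingleton A hb.1.subsingleton, 1, rfl⟩
    rw [← hG.card_solutions A PUnit hA (hC.of_subsingleton _) 1 hα 1 (fun b => ⟨1, rfl⟩)]
    exact mk_subtype_mono (fun f hf => ⟨hf, fun _ => rfl⟩)

/-- Homomorphisms are sorted by their image, one of finitely many subgroups in the class. -/
theorem IsQuasifree.card_continuousMonoidHom_le (hC : IsExtensionClosedVariety C) (hm : ℵ₀ ≤ m)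
    (hG : IsQuasifree C m G) (P : Type u) [Group P] [TopologicalSpace P] [DiscreteTopology P]
    [Finite P] : #(G →ₜ* P) ≤ m := by
  let S := {R : Subgroup P // C R}
  let F : (G →ₜ* P) → Σ R : S, {f : G →ₜ* (R.1 : Subgroup P) // Function.Surjective f} := fun f =>
    ⟨⟨f.toMonoidHom.range, hG.toIsProC.range_mem hC f⟩,
      ⟨⟨f.toMonoidHom.rangeRestrict, f.continuous_toFun.subtype_mk _⟩,
        f.toMonoidHom.rangeRestrict_surjective⟩⟩
  let E : (Σ R : S, {f : G →ₜ* (R.1 : Subgroup P) // Function.Surjective f}) → G → P :=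
    fun x g => (x.2.1 g : P)
  have hF : Function.Injective F := fun f f' h => by
    ext g
    exact congrFun (congrArg E h) g
  refine (mk_le_of_injective hF).trans ?_
  rw [mk_sigma]
  refine (sum_le_sum _ (fun _ => m)
    (fun R : S => hG.card_surjective_le hC hm R.1 R.2)).trans ?_
  rw [sum_const']
  exact mul_le_of_le hm ((lt_aleph0_of_finite S).le.trans hm) le_rfl

/-- The epimorphism `l : H → A` can be recovered from the coset action of `G` on the finite set
`G ⧸ ker l`, whose size does not depend on `l`, together with finitely many further choices. -/
theorem IsQuasifree.card_surjective_subgroup_le (hC : IsExtensionClosedVariety C) (hm : ℵ₀ ≤ m)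
    (hG : IsQuasifree C m G) (H : Subgroup G) (hH : IsOpen (H : Set G))
    (A : Type u) [Group A] [TopologicalSpace A] [DiscreteTopology A] [Finite A] :
    #{l : H →ₜ* A // Function.Surjective l} ≤ m := by
  classical
  have := hG.isTopologicalGroup
  have := hG.compactSpace
  have : Finite (G ⧸ H) := H.quotient_finite_of_isOpen hH
  let X : Type u := (G ⧸ H) × A
  let P : Type u := Equiv.Perm X
  let : TopologicalSpace P := ⊥
  have : DiscreteTopology P := ⟨rfl⟩
  let L := {l : H →ₜ* A // Function.Surjective l}
  let K : L → Subgroup G := fun l => l.1.toMonoidHom.ker.map H.subtype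
  have hK (l : L) : IsOpen (K l : Set G) := Subgroup.isOpen_map_subtype hH l.1.isOpen_ker
  have hcard (l : L) : Nonempty ((G ⧸ K l) ≃ X) := by
    have : Finite (G ⧸ K l) := (K l).quotient_finite_of_isOpen (hK l)
    refine Finite.card_eq.mp ?_
    change (K l).index = Nat.card ((G ⧸ H) × A)
    rw [Nat.card_prod, Subgroup.index_map_subtype, mul_comm]
    congr 1
    exact (Nat.card_congr
      (QuotientGroup.quotientKerEquivOfSurjective l.1.toMonoidHom l.2).toEquiv)
  let e (l : L) : (G ⧸ K l) ≃ X := (hcard l).some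
  let r (l : L) : G →* P :=
    (e l).permCongrHom.toMonoidHom.comp (MulAction.toPermHom G (G ⧸ K l))
  have hr (l : L) : Continuous (r l) := by
    refine (r l).continuous_of_isOpen_ker ?_
    have hker : (r l).ker = (K l).normalCore :=
      (MonoidHom.ker_mulEquiv_comp _ (e l).permCongrHom).trans (K l).normalCore_eq_ker.symm
    rw [hker]
    exact Subgroup.isOpen_normalCore _ (hK l)
  -- `d l` is `l` read on representatives of the cosets of `ker l` that lie in `H`;
  -- its value on the other cosets is irrelevant.
  let d (l : L) (x : X) : A :=
    if hx : ((e l).symm x).out ∈ H then l.1 ⟨_, hx⟩ else 1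
  -- Here `e l 1` is the point of `X` whose stabilizer under `r l` is `ker l`.
  let F : L → (G →ₜ* P) × (X → A) × X := fun l => (⟨r l, hr l⟩, d l, e l (1 : G))
  have key (l : L) (h : H) : d l (r l h (e l (1 : G))) = l.1 h := by
    obtain ⟨⟨_, k, hk, rfl⟩, hout⟩ := QuotientGroup.mk_out_eq_mul (K l) (h : G)
    have hx : (e l).symm (r l h (e l (1 : G))) = ((h : G) : G ⧸ K l) := by
      change (e l).symm (e l ((h : G) • (e l).symm (e l (1 : G)))) = _
      simp
    have hmem : ((e l).symm (r l h (e l (1 : G)))).out ∈ H := by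
      rw [hx, hout]
      exact (h * k).2
    have hval : (⟨_, hmem⟩ : H) = h * k := Subtype.ext ((congrArg Quotient.out hx).trans hout)
    have hk' : l.1 k = 1 := hk
    simp only [d, dif_pos hmem]
    rw [hval, map_mul, hk', mul_one]
  have hF : Function.Injective F := by
    intro l l' hll
    simp only [F, Prod.mk.injEq] at hll
    obtain ⟨h1, h2, h3⟩ := hll
    have h1' (g : G) : r l g = r l' g := congrArg (fun f : G →ₜ* P => f g) h1
    refine Subtype.ext (ContinuousMonoidHom.ext fun h => ?_)
    rw [← key l h, ← key l' h, h1', h2, h3]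
  refine (mk_le_of_injective hF).trans ?_
  rw [mk_prod, lift_id, lift_id]
  exact mul_le_of_le hm (hG.card_continuousMonoidHom_le hC hm P)
    ((lt_aleph0_of_finite _).le.trans hm)

end UpperBound

/-! ### Twisted wreath products -/

section TwistedWreath

variable {Γ H A B : Type u} [Group Γ] [Group H] [Group A] [Group B]

/-- The group induced along `p : H → Γ` from the kernel of `α : A → B`, on which `H` acts by
conjugation through `s : H → A`: the functions `f : Γ → ker α` with
`f (x * p h) = (s h)⁻¹ * f x * s h`. -/
def inducedKernel (p : H →* Γ) (s : H →* A) (α : A →* B) : Subgroup (Γ → A) where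
  carrier := {f | (∀ x, α (f x) = 1) ∧ ∀ x h, f (x * p h) = (s h)⁻¹ * f x * s h}
  one_mem' := ⟨fun x => by simp, fun x h => by simp⟩
  mul_mem' := fun {f f'} hf hf' =>
    ⟨fun x => by simp [hf.1, hf'.1], fun x h => by simp [hf.2, hf'.2, mul_assoc]⟩
  inv_mem' := fun {f} hf => ⟨fun x => by simp [hf.1], fun x h => by simp [hf.2, mul_assoc]⟩

variable (p : H →* Γ) (s : H →* A) (α : A →* B)

/-- The action of `Γ` on the induced group by left translation of the argument. -/
def inducedKernelAction : Γ →* MulAut (inducedKernel p s α) where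
  toFun γ :=
    { toFun := fun f => ⟨fun x => f.1 (γ⁻¹ * x), fun x => f.2.1 _, fun x h => by
        simp only [← mul_assoc, f.2.2]⟩
      invFun := fun f => ⟨fun x => f.1 (γ * x), fun x => f.2.1 _, fun x h => by
        simp only [← mul_assoc, f.2.2]⟩
      left_inv := fun f => by ext x; simp
      right_inv := fun f => by ext x; simp
      map_mul' := fun f f' => rfl }
  map_one' := by ext f x; simp
  map_mul' γ γ' := by ext f x; simp [mul_assoc]

/-- The twisted wreath product of the kernel of `α` by `Γ`: the semidirect product of the induced
group and `Γ`. It depends on the action of `H` on `ker α` given by `s`. -/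
abbrev TwistedWreath : Type u := inducedKernel p s α ⋊[inducedKernelAction p s α] Γ

variable {p s α}

/-- The value at `1` of the `inducedKernel` component. -/
def TwistedWreath.evalOne (w : TwistedWreath p s α) : A := w.left.1 1

theorem TwistedWreath.left_mul_apply (w w' : TwistedWreath p s α) (x : Γ) :
    (w * w').left.1 x = w.left.1 x * w'.left.1 (w.right⁻¹ * x) := rfl

theorem TwistedWreath.map_evalOne (w : TwistedWreath p s α) : α w.evalOne = 1 := w.left.2.1 1

/-- Over the image of `p`, evaluation at `1` satisfies the cocycle identity for the action of `H`
on `ker α` by conjugation through `s`. -/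
theorem TwistedWreath.evalOne_mul {w : TwistedWreath p s α} {h : H} (hw : w.right = p h)
    (w' : TwistedWreath p s α) :
    (w * w').evalOne = w.evalOne * (s h * w'.evalOne * (s h)⁻¹) := by
  have h1 : w.right⁻¹ * 1 = 1 * p h⁻¹ := by rw [hw, map_inv, mul_one, one_mul]
  rw [evalOne, left_mul_apply, h1, w'.left.2.2, map_inv, inv_inv]
  rfl

/-- When `s` is trivial on the kernel of `p`, every element of `ker α` is the value at `1` of
a function in the induced group, supported on the image of `p`. -/
theorem exists_mem_inducedKernel (hps : p.ker ≤ s.ker) {k : A} (hk : α k = 1) :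
    ∃ f : inducedKernel p s α, f.1 1 = k := by
  classical
  let f : Γ → A := fun x => if hx : ∃ h, p h = x then (s hx.choose)⁻¹ * k * s hx.choose else 1
  have hf (h : H) : f (p h) = (s h)⁻¹ * k * s h := by
    have hx : ∃ h', p h' = p h := ⟨h, rfl⟩
    have hs : s hx.choose = s h := by
      rw [← inv_mul_eq_one, ← map_inv, ← map_mul]
      refine hps ?_
      rw [MonoidHom.mem_ker, map_mul, map_inv, hx.choose_spec, inv_mul_cancel]
    simp only [f, dif_pos hx, hs]
  refine ⟨⟨f, fun x => ?_, fun x h => ?_⟩, ?_⟩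
  · by_cases hx : ∃ h, p h = x
    · obtain ⟨h, rfl⟩ := hx
      rw [hf]
      simp [hk]
    · simp only [f, dif_neg hx, map_one]
  · by_cases hx : ∃ h, p h = x
    · obtain ⟨h', rfl⟩ := hx
      rw [← map_mul, hf, hf]
      simp [mul_assoc]
    · have hx' : ¬ ∃ h', p h' = x * p h := by
        rintro ⟨h', hh'⟩
        exact hx ⟨h' * h⁻¹, by rw [map_mul, hh', map_inv, mul_inv_cancel_right]⟩
      simp only [f, dif_neg hx, dif_neg hx']
      simp
  · simpa using hf 1

theorem TwistedWreath.isProperSplitEpi_rightHom (hps : p.ker ≤ s.ker)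
    (hα : ¬ Function.Injective α) :
    IsProperSplitEpi (SemidirectProduct.rightHom : TwistedWreath p s α →* Γ) := by
  refine ⟨SemidirectProduct.rightHom_surjective, fun hb => hα ?_,
    SemidirectProduct.inr, SemidirectProduct.rightHom_comp_inr⟩
  rw [injective_iff_map_eq_one]
  intro k hk
  obtain ⟨f, rfl⟩ := exists_mem_inducedKernel hps hk
  have h1 : (SemidirectProduct.inl f : TwistedWreath p s α) = 1 := hb.1 (by simp)
  rw [SemidirectProduct.inl_injective (h1.trans (map_one _).symm)]
  rfl

theorem IsExtensionClosedVariety.twistedWreath {C : (A : Type u) → [Group A] → Prop}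
    (hC : IsExtensionClosedVariety C) (hΓ : C Γ) (hA : C A) : C (TwistedWreath p s α) := by
  have := hC.finite Γ hΓ
  refine hC.of_surjective_of_ker SemidirectProduct.rightHom
    SemidirectProduct.rightHom_surjective ?_ hΓ
  rw [← SemidirectProduct.range_inl_eq_ker_rightHom]
  exact hC.image _ _ SemidirectProduct.inl.rangeRestrict
    SemidirectProduct.inl.rangeRestrict_surjective
    (hC.subgroup _ (hC.pi Γ (fun _ => A) fun _ => hA) _)

end TwistedWreath

/-! ### Restriction to a subgroup -/

section Restriction

variable {G Γ A B : Type u} [Group G] [Group Γ] [Group A] [Group B] {H : Subgroup G}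
  {π : G →* Γ} {s : H →* A} {α : A →* B}

theorem ker_comp_subtype_le (hπ : π.ker ≤ s.ker.map H.subtype) :
    (π.comp H.subtype).ker ≤ s.ker := by
  intro h hh
  obtain ⟨k, hk, hkh⟩ := hπ (x := (h : G)) hh
  rwa [← Subtype.ext hkh]

/-- Shapiro's map: a homomorphism from `G` to the twisted wreath product, lying over `π`, gives
the homomorphism `h ↦ (l h).evalOne * s h` on `H`. -/
def shapiro (l : G →* TwistedWreath (π.comp H.subtype) s α) (hl : ∀ g, (l g).right = π g) :
    H →* A where
  toFun h := (l h).evalOne * s h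
  map_one' := by simp [TwistedWreath.evalOne]
  map_mul' h h' := by
    rw [Subgroup.coe_mul, map_mul, TwistedWreath.evalOne_mul (h := h) (hl h), map_mul]
    group

theorem map_shapiro (l : G →* TwistedWreath (π.comp H.subtype) s α)
    (hl : ∀ g, (l g).right = π g) (h : H) : α (shapiro l hl h) = α (s h) := by
  change α ((l h).evalOne * s h) = _
  rw [map_mul, TwistedWreath.map_evalOne, one_mul]

/-- The image of a surjective `l` contains an element over `π h₀` with any prescribed value
at `1`; as `ker π ≤ H`, it is the image of an element of `H`. -/
theorem shapiro_surjective (l : G →* TwistedWreath (π.comp H.subtype) s α)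
    (hl : ∀ g, (l g).right = π g) (hπ : π.ker ≤ s.ker.map H.subtype)
    (hs : Function.Surjective (α.comp s)) (hsurj : Function.Surjective l) :
    Function.Surjective (shapiro l hl) := by
  intro a
  obtain ⟨h₀, hh₀⟩ := hs (α a)
  have hps := ker_comp_subtype_le hπ
  have hk : α (a * (s h₀)⁻¹) = 1 := by
    rw [map_mul, map_inv, ← hh₀]
    exact mul_inv_cancel _
  obtain ⟨f, hf⟩ := exists_mem_inducedKernel hps hk
  obtain ⟨g, hg⟩ := hsurj ⟨f, π h₀⟩
  have hgπ : g * (h₀ : G)⁻¹ ∈ π.ker := by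
    rw [MonoidHom.mem_ker, map_mul, map_inv, ← hl g, hg, mul_inv_cancel]
  obtain ⟨k, hk, hkg⟩ := hπ hgπ
  have hgk : ((k * h₀ : H) : G) = g := by
    rw [Subgroup.coe_mul, ← eq_mul_inv_iff_mul_eq]
    exact hkg
  refine ⟨k * h₀, ?_⟩
  change (l ((k * h₀ : H) : G)).evalOne * s (k * h₀) = a
  rw [hgk, hg, map_mul, MonoidHom.mem_ker.mp hk, one_mul]
  change f.1 1 * s h₀ = a
  rw [hf, inv_mul_cancel_right]

/-- The Shapiro image on `H` together with the values on representatives of the cosets of `H`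
determines a homomorphism to the twisted wreath product. -/
theorem eq_of_shapiro_eq (hπ : Function.Surjective π)
    {l l' : G →* TwistedWreath (π.comp H.subtype) s α}
    (hl : ∀ g, (l g).right = π g) (hl' : ∀ g, (l' g).right = π g)
    (hll : shapiro l hl = shapiro l' hl')
    (hout : ∀ q : G ⧸ H, l q.out = l' q.out) : l = l' := by
  have hH (h : H) : (l h).evalOne = (l' h).evalOne :=
    mul_right_cancel (b := s h) (DFunLike.congr_fun hll h)
  -- Write `g` as an element of `H` times the inverse of a representative of a left coset.
  have hone (g : G) : (l g).evalOne = (l' g).evalOne := by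
    obtain ⟨h, hh⟩ := QuotientGroup.mk_out_eq_mul H g⁻¹
    have hg : g = h * ((g⁻¹ : G) : G ⧸ H).out⁻¹ := by rw [hh]; group
    rw [hg, map_mul, map_mul, TwistedWreath.evalOne_mul (h := h) (hl h),
      TwistedWreath.evalOne_mul (h := h) (hl' h), hH, map_inv, map_inv, hout]
  refine MonoidHom.ext fun g =>
    SemidirectProduct.ext (Subtype.ext (funext fun x => ?_)) ?_
  · obtain ⟨y, rfl⟩ := hπ x
    -- Values at other points of `Γ` are quotients of values at `1`, by the cocycle identity.
    have hmul (j : G →* TwistedWreath (π.comp H.subtype) s α) (hj : ∀ g, (j g).right = π g) :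
        (j (y⁻¹ * g)).evalOne = (j y⁻¹).evalOne * (j g).left.1 (π y) := by
      have hy : (j y⁻¹).right⁻¹ * 1 = π y := by rw [hj, map_inv, inv_inv, mul_one]
      rw [map_mul, TwistedWreath.evalOne, TwistedWreath.left_mul_apply, hy]
      rfl
    have h1 := hone (y⁻¹ * g)
    rw [hmul l hl, hmul l' hl', hone] at h1
    exact mul_left_cancel h1
  · rw [hl, hl']

end Restriction

/-! ### Open subgroups of quasifree groups -/

theorem mainTheorem3 (C : (A : Type u) → [Group A] → Prop) (hC : IsExtensionClosedVariety C)
    (m : Cardinal.{u}) (hm : ℵ₀ ≤ m)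
    (G : Type u) [Group G] [TopologicalSpace G] (hG : IsQuasifree C m G)
    (H : Subgroup G) (hH : IsOpen (H : Set G)) :
    IsQuasifree C m H := by
  have := hG.isTopologicalGroup
  have := hG.compactSpace
  refine ⟨hG.toIsProC.of_isOpen hC H hH, ?_⟩
  intro A B _ _ _ _ _ _ hA hB α hα β hβ
  have := hC.finite A hA
  refine le_antisymm ((mk_subtype_mono fun l hl => hl.1).trans
    (hG.card_surjective_subgroup_le hC hm H hH A)) ?_
  obtain ⟨σ, hσ⟩ := hα.split
  have hασ (b : B) : α (σ b) = b := DFunLike.congr_fun hσ b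
  let s : H →* A := σ.comp β.toMonoidHom
  have hs : Continuous s := 
    (continuous_of_discreteTopology (f := σ)).comp β.continuous_toFun
  have hαs (h : H) : α (s h) = β h := hασ _
  let N : Subgroup G := (β.toMonoidHom.ker.map H.subtype).normalCore
  have hN : IsOpen (N : Set G) :=
    Subgroup.isOpen_normalCore _ (Subgroup.isOpen_map_subtype hH β.isOpen_ker)
  have : DiscreteTopology (G ⧸ N) := QuotientGroup.discreteTopology hN
  let π : G →ₜ* G ⧸ N := ⟨QuotientGroup.mk' N, QuotientGroup.continuous_mk⟩
  have hπ : π.toMonoidHom.ker ≤ s.ker.map H.subtype := by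
    have h1 : π.toMonoidHom.ker = N := QuotientGroup.ker_mk' N
    rw [h1]
    refine (Subgroup.normalCore_le _).trans (Subgroup.map_mono fun h hh => ?_)
    change σ (β h) = 1
    rw [show β h = 1 from hh, map_one]
  let W := TwistedWreath (π.toMonoidHom.comp H.subtype) s α
  let : TopologicalSpace W := ⊥
  have : DiscreteTopology W := ⟨rfl⟩
  have hΓ : C (G ⧸ N) := hG.quotient_mem N hN
  have hW : C W := hC.twistedWreath hΓ hA
  have := hC.finite W hW
  have hps := ker_comp_subtype_le hπ
  have hcard := hG.card_solutions W (G ⧸ N) hW hΓ SemidirectProduct.rightHom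
    (TwistedWreath.isProperSplitEpi_rightHom hps
      fun hinj => hα.not_bijective ⟨hinj, hα.surjective⟩)
    π (QuotientGroup.mk'_surjective N)
  let S := solutions (SemidirectProduct.rightHom : W →* G ⧸ N) π
  have : Finite (G ⧸ H) := H.quotient_finite_of_isOpen hH
  -- Finite-to-one passage from solutions for `G` to solutions for `H`.
  let F : S → solutions α β × ((G ⧸ H) → W) := fun l =>
    (⟨⟨shapiro l.1.toMonoidHom l.2.2, by
        have hl : Continuous fun h : H => l.1 (h : G) :=
          l.1.continuous_toFun.comp continuous_subtype_val
        exact ((continuous_of_discreteTopology (f := TwistedWreath.evalOne)).comp hl).mul hs⟩,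
      shapiro_surjective l.1.toMonoidHom l.2.2 hπ
        (fun b => (hβ b).imp fun h hh => (hαs h).trans hh) l.2.1,
      fun h => (map_shapiro l.1.toMonoidHom l.2.2 h).trans (hαs h)⟩,
      fun q => l.1 q.out)
  have hF : Function.Injective F := by
    intro l l' hll
    obtain ⟨h1, h2⟩ := Prod.ext_iff.mp hll
    have h3 : l.1.toMonoidHom = l'.1.toMonoidHom :=
      eq_of_shapiro_eq (QuotientGroup.mk'_surjective N) l.2.2 l'.2.2
        (congrArg (fun x : solutions α β => x.1.toMonoidHom) h1) (congrFun h2)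
    exact Subtype.ext (ContinuousMonoidHom.ext fun g => DFunLike.congr_fun h3 g)
  have hle : m ≤ #(solutions α β) * #((G ⧸ H) → W) := by
    rw [← hcard]
    refine (mk_le_of_injective hF).trans ?_
    rw [mk_prod, lift_id, lift_id]
  have hfin : #((G ⧸ H) → W) < ℵ₀ := lt_aleph0_of_finite _
  have hinf : ℵ₀ ≤ #(solutions α β) := by
    by_contra! hlt
    exact (hm.trans hle).not_gt (mul_lt_aleph0 hlt hfin)
  exact hle.trans (mul_le_of_le hinf le_rfl (hfin.le.trans hinf))
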